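/- A lattice path of semilength $n$ is a path in $\mathbb{Z}\times\mathbb{Z}$ from $(0,0)$ to $(n,n)$ using up steps $U=(0,1)$ and down steps $D=(1,0)$. It is an $(n,m)$-Dyck path if exactly $m$ of its up steps lie below the line $y=x$, and a peak of it is a pair of consecutive steps $UD$. Let $p_{n,m,k}$ denote the number of $(n,m)$-Dyck paths with exactly $k$ peaks. Then for all positive integers $n,m,k$ with $1\le m\le n-2$ and $1\le k\le n-1$, $$p_{n,m,k}+p_{n,n-m,k}=p_{n,m+1,k}+p_{n,n-m-1,k}=\frac{2(n+2)}{n(n-1)}\binom{n}{k-1}\binom{n}{k+1}.$$ -/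

import Mathlib

namespace LatticePath

/-- The two steps: the up step `U = (0,1)` and the down step `D = (1,0)`. -/
inductive Step where
  | U : Step
  | D : Step
  deriving DecidableEq

open Step

instance : Fintype Step := ⟨{U, D}, fun a => by cases a <;> simp⟩

/-- The set `𝓛ₙ` of lattice paths from `(0,0)` to `(n,n)`, as words in the letters `U` and `D`. -/
def paths (n : ℕ) : Set (List Step) :=
  {L | L.count U = n ∧ L.count D = n}

/-- The number of up steps below the line `y = x` of the path that starts at the point `(x,y)` and
follows the given word: the up step from `(x,y)` to `(x,y+1)` is below the line iff `y < x`. -/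
def upsBelowFrom (x y : ℤ) : List Step → ℕ
  | [] => 0
  | U :: L => (if y < x then 1 else 0) + upsBelowFrom x (y + 1) L
  | D :: L => upsBelowFrom (x + 1) y L

/-- The number of up steps below the line `y = x` of the path that starts at the origin. -/
def upsBelow (L : List Step) : ℕ := upsBelowFrom 0 0 L

/-- The number of peaks: pairs of consecutive steps `UD`. -/
def peaks (L : List Step) : ℕ := (L.zip L.tail).count (U, D)

/-- The set of `(n,m)`-Dyck paths: paths from `(0,0)` to `(n,n)` with exactly `m` up steps below
the line `y = x`. -/
def dyckPaths (n m : ℕ) : Set (List Step) :=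
  {L | L ∈ paths n ∧ upsBelow L = m}

/-- The set `𝓟ₙ,ₘ,ₖ` of `(n,m)`-Dyck paths with exactly `k` peaks. -/
def peakPaths (n m k : ℕ) : Set (List Step) :=
  {L | L ∈ dyckPaths n m ∧ peaks L = k}

theorem length_of_mem_paths {n : ℕ} {L : List Step} (h : L ∈ paths n) : L.length = 2 * n := by
  have key : ∀ L : List Step, L.length = L.count U + L.count D := by
    intro L
    induction L with
    | nil => rfl
    | cons a L ih => cases a <;> simp <;> omega
  have h1 := h.1
  have h2 := h.2
  rw [key L]
  omega

/-- There are finitely many such paths, so that `Set.ncard` below is their genuine number. -/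
theorem finite_peakPaths (n m k : ℕ) : (peakPaths n m k).Finite :=
  (List.finite_length_eq Step (2 * n)).subset fun _ h => length_of_mem_paths h.1.1

/-- `p n m k = pₙ,ₘ,ₖ`, the number of `(n,m)`-Dyck paths with exactly `k` peaks. -/
noncomputable def p (n m k : ℕ) : ℕ := (peakPaths n m k).ncard

end LatticePath

/-!
Give a path from `(0,0)` to `(n,n)` the weight `x ^ i * y ^ j * t ^ k`, where `j` of its up steps lie
below the line `y = x`, the other `i` do not, and `k` is its number of peaks. Let `c_x` be the power
series in `z` with `c_x = x z (1 + c_x) (1 + t c_x)`, the generating function of the Narayana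
polynomials (`narayanaSeries_eq`). The generating function `F(x, y)` of all paths satisfies
`F(x, y) (1 - t c_x c_y) = (1 + t c_x) (1 + c_y)` (`seriesAbove_zero_D_mul`). Instead of decomposing
paths, this is proved from the recurrence which removes the first letter of a word: the words that
start at height `h` form a system of linear equations for power series which has only one solution
(`eq_zero_of_eq_X_mul`), and the geometric progressions in `h` with ratios built from `c_x` and `c_y`
solve it (`seriesAbove_eq`, `seriesBelow_eq`).

Exchanging `x` and `y` replaces `m` by `n - m`, so the sum `p n m k + p n (n - m) k` is a coefficient
of `F(x, y) + F(y, x)`. The equations for `c_x` and `c_y` give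
`(x - y) z (1 + c_x) (1 + t c_x) (1 + c_y) (1 + t c_y) = (c_x - c_y) (1 - t c_x c_y)`, and therefore
`(x - y) (F(x, y) + F(y, x) - 2 - (1 + t) (c_x + c_y)) = y H(x) - x H(y)` with
`H(x) = (1 + t) c_x - (1 + t) x z - (1 - t) ^ 2 x z c_x`. The coefficient of `z ^ n` in `H(x)` is
`x ^ n` times a polynomial `h n` in `t`, so in degree `n` the symmetrized generating function is, apart
from multiples of `x ^ n` and `y ^ n`, the product of `h n` with `∑ x ^ i * y ^ (n - i)` over
`0 < i < n` (`sub_mul_totalWeight_add`). This proves that the sum does not depend on `m`.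

The value follows from the closed formula for Narayana numbers (`coeff_narayana`). For `x = y = 1`
the same system of equations counts words by peaks alone, where the answer is a product of two
binomial coefficients (`coeff_totalWeight_D`), and the derivative of `c_1` is one of the series in the
system (`C_mul_derivative_narayanaSeries`).
-/

namespace LatticePath

open Step

/-! ### Words with prescribed numbers of steps -/

/-- The words with `u` up steps and `d` down steps. -/
def words : ℕ → ℕ → Finset (List Step)
  | 0, 0 => {[]}
  | u + 1, 0 => (words u 0).map ⟨List.cons U, List.cons_injective⟩
  | 0, d + 1 => (words 0 d).map ⟨List.cons D, List.cons_injective⟩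
  | u + 1, d + 1 => (words u (d + 1)).map ⟨List.cons U, List.cons_injective⟩ ∪
      (words (u + 1) d).map ⟨List.cons D, List.cons_injective⟩

theorem mem_words {u d : ℕ} {L : List Step} :
    L ∈ words u d ↔ L.count U = u ∧ L.count D = d := by
  induction L generalizing u d with
  | nil => cases u <;> cases d <;> simp [words]
  | cons a L ih =>
    cases u <;> cases d <;> cases a <;> simp [words, ih]

theorem disjoint_map_cons (A B : Finset (List Step)) :
    Disjoint (A.map ⟨List.cons U, List.cons_injective⟩)
      (B.map ⟨List.cons D, List.cons_injective⟩) := by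
  rw [Finset.disjoint_left]
  intro L hL hL'
  simp only [Finset.mem_map, Function.Embedding.coeFn_mk] at hL hL'
  obtain ⟨_, _, rfl⟩ := hL
  obtain ⟨_, _, h⟩ := hL'
  cases h

theorem p_eq_card (n m k : ℕ) :
    p n m k = ((words n n).filter fun L => upsBelow L = m ∧ peaks L = k).card := by
  rw [p, ← Set.ncard_coe_finset]
  congr 1
  ext L
  simp [peakPaths, dyckPaths, paths, mem_words, and_assoc]

theorem peaks_cons_cons (a b : Step) (L : List Step) :
    peaks (a :: b :: L) = (if a = U ∧ b = D then 1 else 0) + peaks (b :: L) := by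
  simp only [peaks, List.tail_cons, List.zip_cons_cons, List.count_cons]
  cases a <;> cases b <;> simp [add_comm]

theorem peaks_D_cons (L : List Step) : peaks (D :: L) = peaks L := by
  cases L with
  | nil => rfl
  | cons b L => simp [peaks_cons_cons]

/-! ### The weight of a word -/

section Weight

variable {R : Type*} [CommRing R]

/-- The factor contributed by a down step whose predecessor is `s`. -/
def peakFactor (t : R) : Step → R
  | U => t
  | D => 1

/-- The weight of a word that is read from height `h` (the value of `y - x`), when the step before
it is `s`: every up step contributes `y` or `x` according to whether it lies below the line
or not, and every peak, including one formed by `s` and the first letter, contributes `t`. -/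
def weight (x y t : R) : ℤ → Step → List Step → R
  | _, _, [] => 1
  | h, _, U :: L => (if h < 0 then y else x) * weight x y t (h + 1) U L
  | h, s, D :: L => peakFactor t s * weight x y t (h - 1) D L

theorem exists_weight_eq (x y t : R) (L : List Step) (s : Step) (i j : ℤ) :
    ∃ a, a + upsBelowFrom i j L = L.count U ∧
      weight x y t (j - i) s L = x ^ a * y ^ upsBelowFrom i j L * t ^ peaks (s :: L) := by
  induction L generalizing s i j with
  | nil => exact ⟨0, by simp [upsBelowFrom, weight, peaks]⟩
  | cons b L ih =>
    cases b with
    | U =>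
      obtain ⟨a, ha, hw⟩ := ih U i (j + 1)
      have e : j - i + 1 = j + 1 - i := by ring
      by_cases h : j < i
      · refine ⟨a, ?_, ?_⟩
        · simp [upsBelowFrom, h, ← ha]; ring
        · have h' : j - i < 0 := by omega
          simp only [weight, if_pos h', upsBelowFrom, if_pos h, e, hw, peaks_cons_cons]
          simp; ring
      · refine ⟨a + 1, ?_, ?_⟩
        · simp [upsBelowFrom, h, ← ha]; ring
        · have h' : ¬ j - i < 0 := by omega
          simp only [weight, if_neg h', upsBelowFrom, if_neg h, e, hw, peaks_cons_cons]
          simp; ring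
    | D =>
      obtain ⟨a, ha, hw⟩ := ih D (i + 1) j
      have e : j - i - 1 = j - (i + 1) := by ring
      refine ⟨a, by simp [upsBelowFrom, ← ha], ?_⟩
      simp only [weight, upsBelowFrom, e, hw, peaks_cons_cons]
      cases s <;> simp [peakFactor]; ring

/-- The total weight of the words with `u` up steps and `d` down steps, read from height `d - u`
(so that they end on the line) after a step `s`. -/
def totalWeight (x y t : R) (u d : ℕ) (s : Step) : R :=
  ∑ L ∈ words u d, weight x y t ((d : ℤ) - u) s L

theorem totalWeight_zero_zero (x y t : R) (s : Step) : totalWeight x y t 0 0 s = 1 := by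
  simp [totalWeight, words, weight]

theorem totalWeight_succ_zero (x y t : R) (u : ℕ) (s : Step) :
    totalWeight x y t (u + 1) 0 s = y * totalWeight x y t u 0 U := by
  have h : (((0 : ℕ) : ℤ) - (u + 1 : ℕ)) < 0 := by omega
  have e : (((0 : ℕ) : ℤ) - (u + 1 : ℕ)) + 1 = (0 : ℕ) - (u : ℤ) := by push_cast; ring
  simp only [totalWeight, words, Finset.sum_map, Function.Embedding.coeFn_mk, weight, if_pos h, e,
    Finset.mul_sum]

theorem totalWeight_zero_succ (x y t : R) (d : ℕ) (s : Step) :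
    totalWeight x y t 0 (d + 1) s = peakFactor t s * totalWeight x y t 0 d D := by
  have e : (((d + 1 : ℕ) : ℤ) - (0 : ℕ)) - 1 = d - (0 : ℕ) := by push_cast; ring
  simp only [totalWeight, words, Finset.sum_map, Function.Embedding.coeFn_mk, weight, e,
    Finset.mul_sum]

theorem totalWeight_succ_succ (x y t : R) (u d : ℕ) (s : Step) :
    totalWeight x y t (u + 1) (d + 1) s =
      (if d < u then y else x) * totalWeight x y t u (d + 1) U +
        peakFactor t s * totalWeight x y t (u + 1) d D := by
  have e₁ : (((d + 1 : ℕ) : ℤ) - (u + 1 : ℕ)) + 1 = (d + 1 : ℕ) - (u : ℤ) := by push_cast; ring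
  have e₂ : (((d + 1 : ℕ) : ℤ) - (u + 1 : ℕ)) - 1 = d - ((u + 1 : ℕ) : ℤ) := by push_cast; ring
  have h : (((d + 1 : ℕ) : ℤ) - (u + 1 : ℕ)) < 0 ↔ d < u := by omega
  simp only [totalWeight, words, Finset.sum_union (disjoint_map_cons _ _), Finset.sum_map,
    Function.Embedding.coeFn_mk, weight, e₁, e₂, Finset.mul_sum, h]

/-- Only the first letter of a word interacts with the step before it. -/
theorem totalWeight_U_succ (x y t : R) (u d : ℕ) :
    totalWeight x y t u (d + 1) U =
      totalWeight x y t u (d + 1) D + (t - 1) * totalWeight x y t u d D := by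
  cases u with
  | zero => simp only [totalWeight_zero_succ, peakFactor]; ring
  | succ u => simp only [totalWeight_succ_succ, peakFactor]; ring

/-! ### Generating functions of words by height -/

open PowerSeries

/-- The generating function, by number of up steps, of the words that start at height `h ≥ 0`. -/
def seriesAbove (x y t : R) (h : ℕ) (s : Step) : R⟦X⟧ :=
  .mk fun u => totalWeight x y t u (u + h) s

/-- The generating function, by number of down steps, of the words that start at
height `-h ≤ 0`. -/
def seriesBelow (x y t : R) (h : ℕ) (s : Step) : R⟦X⟧ :=
  .mk fun d => totalWeight x y t (d + h) d s

theorem seriesBelow_zero (x y t : R) (s : Step) :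
    seriesBelow x y t 0 s = seriesAbove x y t 0 s := rfl

theorem seriesAbove_succ (x y t : R) (h : ℕ) (s : Step) :
    seriesAbove x y t (h + 1) s =
      X * (C x * seriesAbove x y t (h + 2) U) + C (peakFactor t s) * seriesAbove x y t h D := by
  ext n
  cases n with
  | zero =>
    rw [map_add, coeff_zero_X_mul, coeff_C_mul]
    simp [seriesAbove, coeff_mk, ← totalWeight_zero_succ]
  | succ n =>
    have e : n + 1 + (h + 1) = (n + h + 1) + 1 := by ring
    have e' : n + (h + 2) = (n + h + 1) + 1 := by ring
    have e'' : n + 1 + h = n + h + 1 := by ring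
    rw [map_add, coeff_succ_X_mul, coeff_C_mul, coeff_C_mul]
    simp only [seriesAbove, coeff_mk]
    rw [e, e', e'', totalWeight_succ_succ, if_neg (by omega)]

theorem seriesAbove_zero (x y t : R) (s : Step) :
    seriesAbove x y t 0 s = 1 + X * (C x * seriesAbove x y t 1 U) +
      X * (C (peakFactor t s) * seriesBelow x y t 1 D) := by
  ext n
  cases n with
  | zero =>
    rw [map_add, map_add, coeff_zero_X_mul, coeff_zero_X_mul]
    simp [seriesAbove, totalWeight_zero_zero]
  | succ n =>
    rw [map_add, map_add, coeff_succ_X_mul, coeff_succ_X_mul, coeff_C_mul, coeff_C_mul, coeff_one,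
      if_neg (Nat.succ_ne_zero n), zero_add]
    simp only [seriesAbove, seriesBelow, coeff_mk]
    rw [add_zero, totalWeight_succ_succ, if_neg (lt_irrefl n)]

theorem seriesBelow_succ (x y t : R) (h : ℕ) (s : Step) :
    seriesBelow x y t (h + 1) s =
      C y * seriesBelow x y t h U + X * (C (peakFactor t s) * seriesBelow x y t (h + 2) D) := by
  ext n
  cases n with
  | zero =>
    rw [map_add, coeff_zero_X_mul, coeff_C_mul]
    simp [seriesBelow, coeff_mk, totalWeight_succ_zero]
  | succ n =>
    have e : n + 1 + (h + 1) = (n + h + 1) + 1 := by ring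
    have e' : n + (h + 2) = (n + h + 1) + 1 := by ring
    have e'' : n + 1 + h = n + h + 1 := by ring
    rw [map_add, coeff_succ_X_mul, coeff_C_mul, coeff_C_mul]
    simp only [seriesBelow, coeff_mk]
    rw [e, e', e'', totalWeight_succ_succ, if_pos (by omega)]

/-! ### Solving the recurrences -/

/-- A family of power series reproduced by an operator divisible by `X` vanishes: by iteration,
all its members are divisible by every power of `X`. -/
theorem eq_zero_of_eq_X_mul (E : ℕ → R⟦X⟧) (α β : R⟦X⟧)
    (hE : ∀ h, E h = X * (α * E (h + 1) + β * E h)) (h : ℕ) : E h = 0 := by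
  have key : ∀ N h, X ^ N ∣ E h := by
    intro N
    induction N with
    | zero => simp
    | succ N ih =>
      intro h
      rw [hE h, pow_succ']
      exact mul_dvd_mul_left _ (dvd_add ((ih _).mul_left _) ((ih _).mul_left _))
  ext n
  simpa using X_pow_dvd_iff.1 (key (n + 1) h) n n.lt_succ_self

/-- To leave height `h + 1` for the first time downwards, a path makes a possibly empty Dyck path
followed by a down step; hence the factors, which differ according to whether the step before forms
a peak with a first down step. -/
theorem seriesAbove_eq {x y t : R} {c : R⟦X⟧}
    (hc : c = C x * X * ((1 + c) * (1 + C t * c))) (h : ℕ) :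
    seriesAbove x y t (h + 1) D = (1 + C t * c) * seriesAbove x y t h D ∧
      seriesAbove x y t (h + 1) U = C t * (1 + c) * seriesAbove x y t h D := by
  have hD (h) := seriesAbove_succ x y t h D
  have hU (h) := seriesAbove_succ x y t h U
  simp only [peakFactor, map_one, one_mul] at hD hU
  have key := eq_zero_of_eq_X_mul
    (fun h => seriesAbove x y t (h + 1) D - (1 + C t * c) * seriesAbove x y t h D)
    (C x) (C x * C t * (1 + c)) (fun h => by
      linear_combination hD h + X * C x * (hU (h + 1) - hD (h + 1)) -
        C t * seriesAbove x y t h D * hc) h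
  refine ⟨sub_eq_zero.1 key, ?_⟩
  linear_combination key + hU h - hD h

/-- The counterpart of `seriesAbove_eq` below the line, where the path climbs by one level. -/
theorem seriesBelow_eq {x y t : R} {c : R⟦X⟧}
    (hc : c = C y * X * ((1 + c) * (1 + C t * c))) (h : ℕ) :
    seriesBelow x y t (h + 1) U = C y * (1 + C t * c) * seriesBelow x y t h U ∧
      seriesBelow x y t (h + 1) D = C y * (1 + c) * seriesBelow x y t h U := by
  have hD (h) := seriesBelow_succ x y t h D
  have hU (h) := seriesBelow_succ x y t h U
  simp only [peakFactor, map_one, one_mul] at hD hU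
  have key := eq_zero_of_eq_X_mul
    (fun h => seriesBelow x y t (h + 1) D - C y * (1 + c) * seriesBelow x y t h U)
    1 (C y * C t * (1 + c)) (fun h => by
      linear_combination hD h + X * C y * (1 + c) * (hU h - C t * hD h) -
        C y * seriesBelow x y t h U * hc) h
  refine ⟨?_, sub_eq_zero.1 key⟩
  linear_combination C t * key + hU h - C t * hD h

theorem isUnit_one_add_X_mul (f : R⟦X⟧) : IsUnit (1 + X * f) := by
  rw [PowerSeries.isUnit_iff_constantCoeff]
  simp

/-- The closed form `(1 + t a) (1 + b) / (1 - t a b)` of the generating function of all paths. -/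
theorem seriesAbove_zero_D_mul {x y t : R} {a b : R⟦X⟧}
    (ha : a = C x * X * ((1 + a) * (1 + C t * a)))
    (hb : b = C y * X * ((1 + b) * (1 + C t * b))) :
    seriesAbove x y t 0 D * (1 - C t * a * b) = (1 + C t * a) * (1 + b) := by
  have hD := seriesAbove_zero x y t D
  have hV := seriesAbove_zero x y t U
  rw [(seriesAbove_eq ha 0).2, (seriesBelow_eq hb 0).2, seriesBelow_zero] at hD hV
  simp only [peakFactor, map_one, one_mul] at hD hV
  set F := seriesAbove x y t 0 D
  set V := seriesAbove x y t 0 U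
  have ua : IsUnit (1 + C t * a) := by
    have := isUnit_one_add_X_mul (C t * (C x * ((1 + a) * (1 + C t * a))))
    convert this using 2
    linear_combination C t * ha
  have ub : IsUnit (1 + C t * b) := by
    have := isUnit_one_add_X_mul (C t * (C y * ((1 + b) * (1 + C t * b))))
    convert this using 2
    linear_combination C t * hb
  have h₁ : F * (1 + C t * b) = (1 + C t * a) * (1 + C t * b) + (1 + C t * a) * b * V := by
    linear_combination (1 + C t * a) * (1 + C t * b) * hD - C t * (1 + C t * b) * F * ha -
      (1 + C t * a) * V * hb
  have h₂ : V * (1 + C t * a) = (1 + C t * b) * (1 + C t * a + C t * a * F) := by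
    linear_combination (1 + C t * a) * (1 + C t * b) * hV - C t * (1 + C t * b) * F * ha -
      C t * (1 + C t * a) * V * hb
  -- eliminate `V`
  refine ub.mul_left_cancel ?_
  linear_combination h₁ + b * h₂

end Weight

/-! ### Narayana polynomials -/

section Narayana

open PowerSeries

variable {R : Type*} [CommRing R]

/-- The Narayana polynomials evaluated at `t`, normalized so that the `n`-th one (`n ≥ 1`) has
constant term `1`. They are defined by the recursion equivalent to `c = X (1 + c) (1 + t c)` for
their generating function `c`. -/
def narayana (t : R) : ℕ → R
  | 0 => 0
  | n + 1 => (if n = 0 then 1 else 0) + (1 + t) * narayana t n +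
      t * ∑ i : Fin (n + 1), narayana t i * narayana t (n - i)

theorem narayana_succ (t : R) (n : ℕ) :
    narayana t (n + 1) = (if n = 0 then 1 else 0) + (1 + t) * narayana t n +
      t * ∑ ij ∈ Finset.HasAntidiagonal.antidiagonal n, narayana t ij.1 * narayana t ij.2 := by
  rw [narayana, Finset.Nat.sum_antidiagonal_eq_sum_range_succ_mk, Finset.sum_range]

theorem map_narayana {S : Type*} [CommRing S] (f : R →+* S) (t : R) (n : ℕ) :
    f (narayana t n) = narayana (f t) n := by
  induction n using Nat.strong_induction_on with
  | _ n ih =>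
    cases n with
    | zero => simp [narayana]
    | succ n =>
      have hs : ∑ ij ∈ Finset.HasAntidiagonal.antidiagonal n,
          f (narayana t ij.1 * narayana t ij.2) =
          ∑ ij ∈ Finset.HasAntidiagonal.antidiagonal n,
            narayana (f t) ij.1 * narayana (f t) ij.2 := by
        refine Finset.sum_congr rfl fun ij hij => ?_
        have := Finset.HasAntidiagonal.mem_antidiagonal.1 hij
        rw [map_mul, ih ij.1 (by omega), ih ij.2 (by omega)]
      rw [narayana_succ, narayana_succ, map_add, map_add, map_mul, map_mul, map_sum,
        ih n n.lt_succ_self, hs]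
      simp [apply_ite f]

/-- The generating function of the Narayana polynomials, with variable rescaled by `x`. -/
def narayanaSeries (x t : R) : R⟦X⟧ := .mk fun n => x ^ n * narayana t n

theorem narayanaSeries_eq (x t : R) :
    narayanaSeries x t = C x * X * ((1 + narayanaSeries x t) * (1 + C t * narayanaSeries x t)) := by
  ext n
  rw [mul_assoc, coeff_C_mul]
  cases n with
  | zero =>
    rw [coeff_zero_X_mul]
    simp [narayanaSeries, narayana]
  | succ n =>
    have e : (1 + narayanaSeries x t) * (1 + C t * narayanaSeries x t) =
        1 + C (1 + t) * narayanaSeries x t + C t * (narayanaSeries x t * narayanaSeries x t) := by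
      rw [map_add, map_one]; ring
    have hs : ∑ ij ∈ Finset.HasAntidiagonal.antidiagonal n,
        x ^ ij.1 * narayana t ij.1 * (x ^ ij.2 * narayana t ij.2) =
        x ^ n * ∑ ij ∈ Finset.HasAntidiagonal.antidiagonal n,
          narayana t ij.1 * narayana t ij.2 := by
      rw [Finset.mul_sum]
      refine Finset.sum_congr rfl fun ij hij => ?_
      rw [← Finset.HasAntidiagonal.mem_antidiagonal.1 hij]
      ring
    rw [coeff_succ_X_mul, e, map_add, map_add, coeff_C_mul, coeff_C_mul, coeff_mul, coeff_one]
    simp only [narayanaSeries, coeff_mk]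
    rw [hs, narayana_succ]
    split_ifs with h
    · subst h; ring
    · ring

theorem isUnit_one_add_narayanaSeries_mul (x t : R) (f : R⟦X⟧) :
    IsUnit (1 + narayanaSeries x t * f) := by
  rw [PowerSeries.isUnit_iff_constantCoeff, map_add, map_mul, ← coeff_zero_eq_constantCoeff_apply,
    ← coeff_zero_eq_constantCoeff_apply]
  simp [narayanaSeries, narayana]

/-- For `x = y = 1` the derivative of the Narayana series is, up to the factor `t`, the generating
function of all words starting at height `2` after an up step; this gives access to the
coefficients of the Narayana polynomials without Lagrange inversion. -/
theorem C_mul_derivative_narayanaSeries (t : R) :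
    C t * derivative R (narayanaSeries 1 t) = seriesAbove 1 1 t 2 U := by
  have hc := narayanaSeries_eq 1 t
  have h₂ := (seriesAbove_eq (y := 1) hc 1).2
  have h₁ := (seriesAbove_eq (y := 1) hc 0).1
  have h₀ := seriesAbove_zero_D_mul hc hc
  have u := isUnit_one_add_narayanaSeries_mul 1 t (-(C t * narayanaSeries 1 t))
  have hd := congrArg (derivative R) hc
  rw [zero_add] at h₁
  set c := narayanaSeries 1 t
  simp only [map_one, one_mul, Derivation.leibniz, map_add, Derivation.map_one_eq_zero,
    smul_eq_mul, derivative_C, derivative_X] at hd hc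
  set c' := derivative R c
  -- `c' (1 - X φ'(c)) = φ(c)` for `φ(c) = (1 + c) (1 + t c)`, multiplied by `φ(c) = c / X`
  have key : c' * (1 - C t * c * c) = ((1 + c) * (1 + C t * c)) ^ 2 := by
    linear_combination ((1 + c) * (1 + C t * c)) * hd - c' * (1 + C t + 2 * C t * c) * hc
  refine u.mul_left_cancel ?_
  linear_combination C t * key - (1 - C t * c * c) * h₂
    - (1 - C t * c * c) * C t * (1 + c) * h₁ - C t * (1 + c) * (1 + C t * c) * h₀

end Narayana

/-- There are `(u choose k) * (d choose k)` words with `u` up steps, `d` down steps and `k` peaks,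
and the recurrence for words turns into Pascal's rule. -/
theorem coeff_totalWeight_D (u d k : ℕ) :
    (totalWeight 1 1 (Polynomial.X : Polynomial ℚ) u d D).coeff k =
      u.choose k * d.choose k := by
  induction u generalizing d k with
  | zero =>
    induction d generalizing k with
    | zero => cases k <;> simp [totalWeight_zero_zero, Polynomial.coeff_one]
    | succ d ih =>
      rw [totalWeight_zero_succ, peakFactor, one_mul, ih]
      cases k <;> simp
  | succ u ihu =>
    induction d generalizing k with
    | zero =>
      rw [totalWeight_succ_zero, ← one_mul (totalWeight 1 1 _ u 0 U)]
      have : totalWeight 1 1 (Polynomial.X : Polynomial ℚ) u 0 U =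
          totalWeight 1 1 (Polynomial.X : Polynomial ℚ) u 0 D := by
        cases u <;> simp [totalWeight_zero_zero, totalWeight_succ_zero]
      rw [this, one_mul, one_mul, ihu]
      cases k <;> simp
    | succ d ihd =>
      rw [totalWeight_succ_succ, ite_self, one_mul, peakFactor, one_mul, totalWeight_U_succ,
        Polynomial.coeff_add, Polynomial.coeff_add, ihu, ihd, sub_mul, one_mul,
        Polynomial.coeff_sub, ihu]
      cases k with
      | zero => simp
      | succ k =>
        rw [Polynomial.coeff_X_mul, ihu]
        simp only [Nat.choose_succ_succ]
        push_cast
        ring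

/-- The closed formula for the Narayana numbers, without division. -/
theorem coeff_narayana (n k : ℕ) :
    n * (narayana (Polynomial.X : Polynomial ℚ) n).coeff k = n.choose k * n.choose (k + 1) := by
  cases n with
  | zero => simp
  | succ n =>
    have h := congrArg (PowerSeries.coeff n)
      (C_mul_derivative_narayanaSeries (Polynomial.X : Polynomial ℚ))
    rw [PowerSeries.coeff_C_mul, PowerSeries.coeff_derivative] at h
    simp only [narayanaSeries, seriesAbove, PowerSeries.coeff_mk, one_pow, one_mul] at h
    rw [totalWeight_U_succ] at h
    have h' := congrArg (Polynomial.coeff · (k + 1)) h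
    simp only [Polynomial.coeff_X_mul, Polynomial.coeff_add, coeff_totalWeight_D, sub_mul, one_mul,
      Polynomial.coeff_sub] at h'
    rw [← Nat.cast_succ, ← Polynomial.C_eq_natCast, Polynomial.coeff_mul_C] at h'
    rw [mul_comm, h']
    simp only [Nat.choose_succ_succ]
    push_cast
    ring

/-! ### Adding the two symmetric generating functions -/

section Symmetrization

open PowerSeries

variable {R : Type*} [CommRing R]

/-- The common value of the coefficients strictly between the extreme ones in the symmetrized
generating function of the paths of semilength `n + 1`, see `sub_mul_totalWeight_add`. -/
def plateau (t : R) (n : ℕ) : R :=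
  (1 + t) * narayana t (n + 1) - (1 - t) ^ 2 * narayana t n

/-- After the extreme terms are removed, the symmetrized generating function of the paths of
semilength `n + 2` is a multiple of `x * y * (x ^ (n + 1) - y ^ (n + 1)) / (x - y)`. -/
theorem sub_mul_totalWeight_add (x y t : R) (n : ℕ) :
    (x - y) * (totalWeight x y t (n + 2) (n + 2) D + totalWeight y x t (n + 2) (n + 2) D -
      (1 + t) * narayana t (n + 2) * (x ^ (n + 2) + y ^ (n + 2))) =
      plateau t (n + 1) * (x ^ (n + 2) * y - x * y ^ (n + 2)) := by
  have ha := narayanaSeries_eq x t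
  have hb := narayanaSeries_eq y t
  have hF := seriesAbove_zero_D_mul ha hb
  have hG := seriesAbove_zero_D_mul hb ha
  have u := isUnit_one_add_narayanaSeries_mul x t (-(C t * narayanaSeries y t))
  have key : C (x - y) * (seriesAbove x y t 0 D + seriesAbove y x t 0 D - C 2 -
      C (1 + t) * (narayanaSeries x t + narayanaSeries y t)) =
      C y * (C (1 + t) * narayanaSeries x t - C ((1 + t) * x) * X -
        X * (C ((1 - t) ^ 2 * x) * narayanaSeries x t)) -
      C x * (C (1 + t) * narayanaSeries y t - C ((1 + t) * y) * X -
        X * (C ((1 - t) ^ 2 * y) * narayanaSeries y t)) := by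
    set a := narayanaSeries x t
    set b := narayanaSeries y t
    -- The factor `1 - t a b` clears the denominators of both generating functions, and the factor
    -- `X` lets `x` and `y` be eliminated through the equations of `a` and `b`.
    refine u.mul_left_cancel (X_mul_cancel ?_)
    have h2 : (C 2 : R⟦X⟧) = 2 := map_ofNat C 2
    simp only [map_sub, map_add, map_mul, map_pow, map_one, h2]
    linear_combination (C x - C y) * X * (hF + hG) -
      (1 - C t * a * b) * (C y * X) * (1 + C t) * ha +
      (1 - C t * a * b) * (C x * X) * (1 + C t) * hb +
      C t * (4 + (1 + C t) * (a + b)) * (C x * X * a * hb - C y * X * b * ha)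
  have h := congrArg (coeff (n + 2)) key
  have h2 : coeff (n + 2) (C 2 : R⟦X⟧) = 0 := by rw [coeff_C, if_neg (by omega)]
  have hX : coeff (n + 2) (X : R⟦X⟧) = 0 := by rw [coeff_X, if_neg (by omega)]
  simp only [coeff_C_mul, LinearMap.map_sub, LinearMap.map_add, coeff_succ_X_mul, h2, hX,
    seriesAbove, narayanaSeries, coeff_mk, add_zero] at h
  rw [plateau]
  linear_combination h

end Symmetrization

/-! ### Coefficient extraction -/

/-- Division of `X ^ n - X` by `X - 1`: all coefficients strictly between `0` and `n` agree. -/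
theorem coeff_eq_of_X_sub_one_mul_eq {S : Type*} [CommRing S] {q : Polynomial S} {a : S} {n : ℕ}
    (h : (Polynomial.X - 1) * q = Polynomial.C a * (Polynomial.X ^ n - Polynomial.X)) {j : ℕ}
    (hj : 1 ≤ j) (hjn : j < n) : q.coeff j = a := by
  have hs (i : ℕ) : q.coeff i - q.coeff (i + 1) =
      a * ((if i + 1 = n then 1 else 0) - if i = 0 then 1 else 0) := by
    have := congrArg (Polynomial.coeff · (i + 1)) h
    simpa [sub_mul, Polynomial.coeff_X_mul, Polynomial.coeff_X_pow, Polynomial.coeff_X] using this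
  have h0 : q.coeff 0 = 0 := by
    have := congrArg (Polynomial.coeff · 0) h
    have hn : ¬ 0 = n := by omega
    simpa [sub_mul, Polynomial.coeff_X_pow, hn] using this
  induction j, hj using Nat.le_induction with
  | base =>
    have := hs 0
    rw [h0, if_neg (by omega), if_pos rfl] at this
    linear_combination -this
  | succ j hj ih =>
    have := hs j
    rw [if_neg (by omega), if_neg (by omega), ih (by omega)] at this
    linear_combination -this

theorem coeff_coeff_X_pow_mul (a b m k : ℕ) :
    ((Polynomial.X ^ a * Polynomial.C (Polynomial.X : Polynomial ℚ) ^ b).coeff m).coeff k =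
      if a = m ∧ b = k then 1 else 0 := by
  rw [← Polynomial.C_pow, Polynomial.coeff_mul_C, Polynomial.coeff_X_pow]
  by_cases h : m = a
  · simp [h, Polynomial.coeff_X_pow, eq_comm]
  · simp [h, Ne.symm h]

/-- At `(x, y) = (1, X)` the exponent of `X` counts the up steps below the line. -/
theorem coeff_totalWeight_one_X (n m k : ℕ) :
    ((totalWeight 1 Polynomial.X (Polynomial.C (Polynomial.X : Polynomial ℚ)) n n D).coeff m).coeff
      k = p n m k := by
  rw [totalWeight, Polynomial.finsetSum_coeff, Polynomial.finsetSum_coeff, p_eq_card,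
    Finset.card_filter, Nat.cast_sum]
  refine Finset.sum_congr rfl fun L _ => ?_
  obtain ⟨a, -, hw⟩ :=
    exists_weight_eq 1 Polynomial.X (Polynomial.C (Polynomial.X : Polynomial ℚ)) L D 0 0
  rw [sub_self] at hw ⊢
  rw [hw, one_pow, one_mul, coeff_coeff_X_pow_mul, peaks_D_cons]
  rw [upsBelow]
  split_ifs <;> simp

/-- At `(x, y) = (X, 1)` the exponent of `X` counts the up steps that are not below the line. -/
theorem coeff_totalWeight_X_one {n m k : ℕ} (hmn : m ≤ n) :
    ((totalWeight Polynomial.X 1 (Polynomial.C (Polynomial.X : Polynomial ℚ)) n n D).coeff m).coeff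
      k = p n (n - m) k := by
  rw [totalWeight, Polynomial.finsetSum_coeff, Polynomial.finsetSum_coeff, p_eq_card,
    Finset.card_filter, Nat.cast_sum]
  refine Finset.sum_congr rfl fun L hL => ?_
  obtain ⟨a, ha, hw⟩ :=
    exists_weight_eq Polynomial.X 1 (Polynomial.C (Polynomial.X : Polynomial ℚ)) L D 0 0
  rw [(mem_words.1 hL).1] at ha
  rw [sub_self] at hw ⊢
  have e : a = m ↔ upsBelow L = n - m := by rw [upsBelow]; omega
  rw [hw, one_pow, mul_one, coeff_coeff_X_pow_mul, peaks_D_cons]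
  simp [e]

/-- The sum of the two path numbers is read off from the plateau of the symmetrized generating
function, specialized to `(x, y) = (X, 1)`. -/
theorem p_add_p_eq_coeff_plateau {n m : ℕ} (hm : 1 ≤ m) (hmn : m < n + 2) (k : ℕ) :
    ((p (n + 2) m k + p (n + 2) (n + 2 - m) k : ℕ) : ℚ) =
      (plateau (Polynomial.X : Polynomial ℚ) (n + 1)).coeff k := by
  have h := sub_mul_totalWeight_add Polynomial.X 1 (Polynomial.C (Polynomial.X : Polynomial ℚ)) n
  have hC (i : ℕ) : narayana (Polynomial.C (Polynomial.X : Polynomial ℚ)) i =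
      Polynomial.C (narayana Polynomial.X i) := (map_narayana _ _ _).symm
  have hP : plateau (Polynomial.C (Polynomial.X : Polynomial ℚ)) (n + 1) =
      Polynomial.C (plateau Polynomial.X (n + 1)) := by
    simp only [plateau, hC, map_sub, map_mul, map_add, map_pow, map_one]
  rw [hP, one_pow, mul_one, mul_one] at h
  -- The subtracted term only has coefficients in the degrees `0` and `n + 2`.
  have h' := coeff_eq_of_X_sub_one_mul_eq h hm hmn
  have hz : ((1 + Polynomial.C (Polynomial.X : Polynomial ℚ)) *
      narayana (Polynomial.C (Polynomial.X : Polynomial ℚ)) (n + 2) *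
      (Polynomial.X ^ (n + 2) + 1)).coeff m = 0 := by
    rw [hC, ← Polynomial.C_1, ← Polynomial.C_add, ← Polynomial.C_mul, Polynomial.coeff_C_mul,
      Polynomial.coeff_add, Polynomial.coeff_X_pow, Polynomial.coeff_C, if_neg (by omega),
      if_neg (by omega), add_zero, mul_zero]
  rw [Polynomial.coeff_sub, hz, sub_zero, Polynomial.coeff_add] at h'
  rw [← h', Polynomial.coeff_add, coeff_totalWeight_one_X, coeff_totalWeight_X_one hmn.le]
  push_cast
  ring

theorem cast_choose_succ (n k : ℕ) :
    (n.choose (k + 1) : ℚ) = n.choose k * (n - k) / (k + 1) := by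
  rw [eq_div_iff (by positivity)]
  rcases le_or_gt k n with h | h
  · rw [← Nat.cast_sub h]
    exact_mod_cast Nat.choose_succ_right_eq n k
  · simp [Nat.choose_eq_zero_of_lt h, Nat.choose_eq_zero_of_lt (h.trans k.lt_succ_self)]

theorem coeff_plateau (n k : ℕ) :
    (plateau (Polynomial.X : Polynomial ℚ) (n + 1)).coeff (k + 1) =
      2 * ((n : ℚ) + 4) / (((n : ℚ) + 2) * ((n : ℚ) + 1)) *
        ((n + 2).choose k : ℚ) * ((n + 2).choose (k + 2) : ℚ) := by
  have hN (i j : ℕ) : (narayana (Polynomial.X : Polynomial ℚ) (i + 1)).coeff j =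
      (i + 1).choose j * (i + 1).choose (j + 1) / ((i : ℚ) + 1) := by
    rw [eq_div_iff (by positivity), ← coeff_narayana]
    push_cast
    ring
  have e : plateau (Polynomial.X : Polynomial ℚ) (n + 1) =
      narayana Polynomial.X (n + 2) - narayana Polynomial.X (n + 1) +
      Polynomial.X * (narayana Polynomial.X (n + 2) + 2 * narayana Polynomial.X (n + 1) -
        Polynomial.X * narayana Polynomial.X (n + 1)) := by
    rw [plateau]; ring
  have h2 (q : Polynomial ℚ) (i : ℕ) : (2 * q).coeff i = 2 * q.coeff i := by
    rw [two_mul, Polynomial.coeff_add, two_mul]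
  rw [e, Polynomial.coeff_add, Polynomial.coeff_sub, Polynomial.coeff_X_mul, Polynomial.coeff_sub,
    Polynomial.coeff_add, h2, hN, hN, hN, hN]
  -- Every binomial coefficient is now a rational multiple of the one with the smallest lower index.
  cases k with
  | zero =>
    simp only [Polynomial.coeff_X_mul_zero, zero_add, Nat.choose_succ_succ (n + 1),
      cast_choose_succ, Nat.choose_zero_right, Nat.cast_add]
    push_cast
    field_simp
    ring
  | succ k =>
    rw [Polynomial.coeff_X_mul, hN]
    simp only [Nat.choose_succ_succ (n + 1), cast_choose_succ, Nat.cast_add]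
    push_cast
    field_simp
    ring

end LatticePath

theorem mainTheorem6 (n m k : ℕ) (hm : 1 ≤ m) (hmn : m + 2 ≤ n) (hk : 1 ≤ k) (hkn : k + 1 ≤ n) :
    LatticePath.p n m k + LatticePath.p n (n - m) k =
        LatticePath.p n (m + 1) k + LatticePath.p n (n - m - 1) k ∧
      ((LatticePath.p n (m + 1) k + LatticePath.p n (n - m - 1) k : ℕ) : ℚ) =
        2 * ((n : ℚ) + 2) / ((n : ℚ) * ((n : ℚ) - 1)) *
          (n.choose (k - 1) : ℚ) * (n.choose (k + 1) : ℚ) := by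
  obtain ⟨n, rfl⟩ := Nat.exists_eq_add_of_le' (show 2 ≤ n by omega)
  obtain ⟨k, rfl⟩ := Nat.exists_eq_add_of_le' hk
  have h₁ := LatticePath.p_add_p_eq_coeff_plateau hm (show m < n + 2 by omega) (k + 1)
  have h₂ := LatticePath.p_add_p_eq_coeff_plateau (show 1 ≤ m + 1 by omega)
    (show m + 1 < n + 2 by omega) (k + 1)
  rw [← Nat.sub_sub] at h₂
  refine ⟨by exact_mod_cast h₁.trans h₂.symm, ?_⟩
  rw [h₂, LatticePath.coeff_plateau, Nat.add_sub_cancel]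
  push_cast
  ring
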